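/- **Definitions.** An *MT-algebra* is a pair $M=(B,\square)$ where $B$ is a complete boolean algebra and $\square$ is an interior operator on $B$ ($\square 1=1$, $\square(a\wedge b)=\square a\wedge\square b$, $\square a\le a$, $\square a\le\square\square a$); put $\diamond a=\neg\square\neg a$. An *MT-morphism* $f:M\to N$ is a complete boolean homomorphism with $f(\square a)\le\square f(a)$ for all $a$. An element $a\in M$ is *open* if $a=\square a$, *closed* if $a=\diamond a$, *saturated* if it is a meet of open elements, *weakly locally closed* if it is the meet of a saturated and a closed element, and *compact* if for every set $S$ of open elements with $a\le\bigvee S$ there is a finite $T\subseteq S$ with $a\le\bigvee T$. Let $\mathcal O(M)$ be the frame of open elements of $M$. A subset of $M$ *join-generates* $M$ if every element of $M$ is a join of elements of the subset. $M$ is - *Hausdorff* if the elements $a$ with $a=\bigwedge\{\diamond\square c\mid a\le\square c\}$ join-generate $M$; - *locally compact* if each open $u$ is the join of the open $v$ for which there is a compact $k$ with $v\le k\le u$; - *spatial* if its boolean algebra is atomic; - *sober* if the weakly locally closed elements join-generate $M$ and every join-irreducible element of the lattice of closed elements is $\diamond x$ for some atom $x$. An MT-morphism is *proper* if it maps compact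 saturated elements to compact saturated elements. In a frame, $a\ll b$ means that $b\le\bigvee S$ implies $a\le\bigvee T$ for some finite $T\subseteq S$; a frame is *continuous* if $a=\bigvee\{b\mid b\ll a\}$ for all $a$, and *regular* if $a=\bigvee\{b\mid b^*\vee a=1\}$ for all $a$, where $b^*$ is the pseudocomplement of $b$. A frame homomorphism is *proper* if it preserves $\ll$. A continuous map is *proper* if preimages of compact saturated sets are compact (a set is saturated if it is an intersection of open sets). Let $\mathbf{LCHMT}$ be the category of locally compact Hausdorff MT-algebras and proper MT-morphisms, $\mathbf{CRegFrm}$ the category of continuous regular frames and proper frame homomorphisms, and $\mathbf{LCHaus}$ the category of locally compact Hausdorff spaces and proper continuous maps. Let $\mathcal O$ be the functor from MT-algebras to frames sending $M$ to $\mathcal O(M)$ and $f$ to its restriction. Let $\Omega$ be the contravariant functor sending a space to its frame of open sets and a continuous map to its inverse image map. Let $\mathcal P$ be the contravariant functor sending a space $X$ to $(\mathcal P(X),\mathrm{int})$ and $f$ to $f^{-1}$. Let $\mathrm{at}$ be the contravariant functor sending an MT-algebra $M$ to its set of atoms with the open sets $\eta(u)$, $u\in\mathcal O(M)$, where $\eta(a)=\{x\mid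 x\text{ an atom},\ x\le a\}$, and sending $f$ to $x\mapsto\bigwedge\{a\mid x\le f(a)\}$. The functors $\mathcal P$ and $\mathrm{at}$ form a dual adjunction between topological spaces and MT-algebras with units $\eta:M\to\mathcal P(\mathrm{at}(M))$ and $\varepsilon:X\to\mathrm{at}(\mathcal P(X))$, $\varepsilon(x)=\{x\}$. **Theorem.** Every locally compact Hausdorff MT-algebra is sober and spatial. Moreover: 1. $\mathcal O$ restricts to a functor $\mathbf{LCHMT}\to\mathbf{CRegFrm}$, and this restriction is an equivalence of categories. 2. The dual adjunction $(\mathcal P,\mathrm{at})$ restricts to a dual equivalence between $\mathbf{LCHMT}$ and $\mathbf{LCHaus}$: $\mathrm{at}$ and $\mathcal P$ restrict to contravariant functors between these categories, and $\eta$ and $\varepsilon$ are natural isomorphisms there. 3. Consequently $\mathbf{CRegFrm}$ is dually equivalent to $\mathbf{LCHaus}$: the composite $\mathcal O\circ\mathcal P:\mathbf{LCHaus}^{\mathrm{op}}\to\mathbf{CRegFrm}$ is an equivalence, and it is naturally isomorphic to the restriction of $\Omega$. -/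

import Mathlib

open CategoryTheory Opposite

universe u v w v' w'

noncomputable section

/-! ## Subcategories, and functors restricting to them -/

/-- A subcategory of `C`: a class of objects, and a class of morphisms containing the identities
and closed under composition. Its morphisms are the morphisms of the given class between objects
of the given class. -/
structure Subcat (C : Type w) [Category.{v} C] where
  obj : C → Prop
  hom : ∀ ⦃X Y : C⦄, (X ⟶ Y) → Prop
  id_mem : ∀ X : C, hom (𝟙 X)
  comp_mem : ∀ ⦃X Y Z : C⦄ (f : X ⟶ Y) (g : Y ⟶ Z), hom f → hom g → hom (f ≫ g)

namespace Subcat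

variable {C : Type w} [Category.{v} C] {D : Type w'} [Category.{v'} D]

/-- The objects of a subcategory. -/
structure Cat (S : Subcat C) where
  val : C
  property : S.obj val

/-- The morphisms of a subcategory. -/
@[ext]
structure Hom {S : Subcat C} (X Y : S.Cat) where
  val : X.val ⟶ Y.val
  property : S.hom val

instance (S : Subcat C) : Category S.Cat where
  Hom X Y := Hom X Y
  id X := ⟨𝟙 X.val, S.id_mem X.val⟩
  comp f g := ⟨f.val ≫ g.val, S.comp_mem f.val g.val f.property g.property⟩
  id_comp f := Hom.ext (Category.id_comp f.val)
  comp_id f := Hom.ext (Category.comp_id f.val)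
  assoc f g h := Hom.ext (Category.assoc f.val g.val h.val)

/-- A covariant functor maps the subcategory `S` into the subcategory `T`. -/
structure Restricts (F : C ⥤ D) (S : Subcat C) (T : Subcat D) : Prop where
  obj : ∀ X, S.obj X → T.obj (F.obj X)
  map : ∀ ⦃X Y : C⦄ (f : X ⟶ Y), S.obj X → S.obj Y → S.hom f → T.hom (F.map f)

/-- A contravariant functor `C ⥤ Dᵒᵖ` maps the subcategory `S` into the subcategory `T`. -/
structure RestrictsToOp (F : C ⥤ Dᵒᵖ) (S : Subcat C) (T : Subcat D) : Prop where
  obj : ∀ X, S.obj X → T.obj (F.obj X).unop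
  map : ∀ ⦃X Y : C⦄ (f : X ⟶ Y), S.obj X → S.obj Y → S.hom f → T.hom (F.map f).unop

/-- A contravariant functor `Cᵒᵖ ⥤ D` maps the subcategory `S` into the subcategory `T`. -/
structure RestrictsOfOp (F : Cᵒᵖ ⥤ D) (S : Subcat C) (T : Subcat D) : Prop where
  obj : ∀ X : C, S.obj X → T.obj (F.obj (op X))
  map : ∀ ⦃X Y : C⦄ (f : X ⟶ Y), S.obj X → S.obj Y → S.hom f → T.hom (F.map f.op)

variable {S : Subcat C} {T : Subcat D}

/-- The restriction `S ⥤ T` of a functor `F : C ⥤ D`. -/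
def Restricts.functor {F : C ⥤ D} (h : Restricts F S T) : S.Cat ⥤ T.Cat where
  obj X := ⟨F.obj X.val, h.obj X.val X.property⟩
  map {X Y} f := ⟨F.map f.val, h.map f.val X.property Y.property f.property⟩
  map_id X := Hom.ext (F.map_id X.val)
  map_comp f g := Hom.ext (F.map_comp f.val g.val)

/-- The restriction `S ⥤ Tᵒᵖ` of a functor `F : C ⥤ Dᵒᵖ`. -/
def RestrictsToOp.functor {F : C ⥤ Dᵒᵖ} (h : RestrictsToOp F S T) : S.Cat ⥤ T.Catᵒᵖ where
  obj X := op ⟨(F.obj X.val).unop, h.obj X.val X.property⟩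
  map {X Y} f := Quiver.Hom.op
    ⟨(F.map f.val).unop, h.map f.val X.property Y.property f.property⟩
  map_id X := congrArg Quiver.Hom.op (Hom.ext (congrArg Quiver.Hom.unop (F.map_id X.val)))
  map_comp f g := congrArg Quiver.Hom.op
    (Hom.ext (congrArg Quiver.Hom.unop (F.map_comp f.val g.val)))

/-- The restriction `Sᵒᵖ ⥤ T` of a functor `F : Cᵒᵖ ⥤ D`. -/
def RestrictsOfOp.functor {F : Cᵒᵖ ⥤ D} (h : RestrictsOfOp F S T) : S.Catᵒᵖ ⥤ T.Cat where
  obj X := ⟨F.obj (op X.unop.val), h.obj X.unop.val X.unop.property⟩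
  map {X Y} f := ⟨F.map f.unop.val.op,
    h.map f.unop.val Y.unop.property X.unop.property f.unop.property⟩
  map_id X := Hom.ext (F.map_id (op X.unop.val))
  map_comp f g := Hom.ext (F.map_comp f.unop.val.op g.unop.val.op)

/-- The dual adjunction `F ⊣ G` between `C` and `D` restricts to a dual equivalence between the
subcategories `S` and `T`, where `F` and `G` map `S` and `T` into each other by `hF` and `hG`:
the units of the adjunction at the objects of `S` and `T` are the components of natural
isomorphisms of the categories `S` and `T`. -/
def RestrictsToDualEquivalence {F : C ⥤ Dᵒᵖ} {G : Dᵒᵖ ⥤ C} (adj : F ⊣ G)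
    (hF : RestrictsToOp F S T) (hG : RestrictsOfOp G T S) : Prop :=
  ∃ (η : 𝟭 S.Cat ≅ hF.functor ⋙ hG.functor) (ε : hG.functor ⋙ hF.functor ≅ 𝟭 T.Catᵒᵖ),
    (∀ M : S.Cat, (η.hom.app M).val = adj.unit.app M.val) ∧
    (∀ X : T.Cat, (ε.hom.app (op X)).unop.val = (adj.counit.app (op X.val)).unop)

end Subcat

/-! ## MT-algebras -/

/-- An MT-algebra: a complete boolean algebra with an interior operator. -/
structure MTAlg where
  carrier : Type u
  [str : CompleteBooleanAlgebra carrier]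
  box : carrier → carrier
  box_top : box ⊤ = ⊤
  box_inf : ∀ a b, box (a ⊓ b) = box a ⊓ box b
  box_le : ∀ a, box a ≤ a
  box_le_box_box : ∀ a, box a ≤ box (box a)

namespace MTAlg

instance : CoeSort MTAlg.{u} (Type u) := ⟨MTAlg.carrier⟩

instance (M : MTAlg.{u}) : CompleteBooleanAlgebra M := M.str

/-- MT-morphisms: complete boolean homomorphisms `f` with `f (□ a) ≤ □ (f a)`. A map preserving
all joins and meets, so `⊥` and `⊤` too, automatically preserves complements. -/
@[ext]
structure Hom (M N : MTAlg.{u}) where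
  toHom : CompleteLatticeHom M N
  map_box_le : ∀ a : M, toHom (M.box a) ≤ N.box (toHom a)

lemma box_mono (M : MTAlg.{u}) {a b : M} (h : a ≤ b) : M.box a ≤ M.box b := by
  have := M.box_inf a b
  rw [inf_eq_left.2 h] at this
  exact inf_eq_left.1 this.symm

instance : Category MTAlg.{u} where
  Hom M N := Hom M N
  id M := ⟨CompleteLatticeHom.id M, fun _ => le_rfl⟩
  comp {M N K} f g := ⟨g.toHom.comp f.toHom, fun a =>
    ((OrderHomClass.mono g.toHom) (f.map_box_le a)).trans (g.map_box_le (f.toHom a))⟩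

lemma hom_ext' {M N : MTAlg.{u}} {f g : M ⟶ N} (h : ∀ a, f.toHom a = g.toHom a) : f = g :=
  Hom.ext (DFunLike.ext _ _ h)

@[simp] lemma id_toHom_apply (M : MTAlg.{u}) (a : M) : (𝟙 M : M ⟶ M).toHom a = a := rfl

@[simp] lemma comp_toHom_apply {M N K : MTAlg.{u}} (f : M ⟶ N) (g : N ⟶ K) (a : M) :
    (f ≫ g).toHom a = g.toHom (f.toHom a) := rfl

section Elements

variable (M : MTAlg.{u})

/-- The closure operator `◇ = ¬ □ ¬`. -/
def dia (a : M) : M := (M.box aᶜ)ᶜ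

def IsOpen (a : M) : Prop := a = M.box a

def IsClosed (a : M) : Prop := a = M.dia a

/-- Saturated elements: the meets of open elements. -/
def IsSaturated (a : M) : Prop := ∃ U : Set M, (∀ u ∈ U, M.IsOpen u) ∧ a = sInf U

/-- Compact elements. -/
def IsCompact (a : M) : Prop :=
  ∀ U : Set M, (∀ u ∈ U, M.IsOpen u) → a ≤ sSup U → ∃ V ⊆ U, V.Finite ∧ a ≤ sSup V

/-- A class of elements join-generates `M`: each element is a join of elements of the class. -/
def JoinGenerates (P : M → Prop) : Prop := ∀ a : M, a = sSup {c | P c ∧ c ≤ a}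

/-- Weakly locally closed elements: the meets of a saturated and a closed element. -/
def IsWeaklyLocallyClosed (a : M) : Prop :=
  ∃ s c : M, M.IsSaturated s ∧ M.IsClosed c ∧ a = s ⊓ c

/-- `M` is sober: it is a `T₀`-algebra, and each join-irreducible element of the lattice of closed
elements is the closure of an atom. -/
def IsSober : Prop :=
  M.JoinGenerates M.IsWeaklyLocallyClosed ∧
  ∀ p : M, M.IsClosed p → p ≠ ⊥ →
    (∀ a b : M, M.IsClosed a → M.IsClosed b → p = a ⊔ b → p = a ∨ p = b) →
    ∃ x : M, IsAtom x ∧ p = M.dia x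

/-- `M` is spatial: its boolean algebra is atomic. -/
def IsSpatial : Prop := ∀ a : M, a ≠ ⊥ → ∃ x : M, IsAtom x ∧ x ≤ a

/-- Elements approximated from above by regular closed elements. -/
def IsApproximated (a : M) : Prop := a = sInf {d | ∃ c : M, a ≤ M.box c ∧ d = M.dia (M.box c)}

/-- `M` is Hausdorff. -/
def IsHausdorff : Prop := M.JoinGenerates M.IsApproximated

/-- `a ◁ b`: there is a compact element between `a` and `b`. -/
def Inside (a b : M) : Prop := ∃ k : M, M.IsCompact k ∧ a ≤ k ∧ k ≤ b

/-- `M` is locally compact. -/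
def IsLocallyCompact : Prop :=
  ∀ a : M, M.IsOpen a → a = sSup {b | M.IsOpen b ∧ M.Inside b a}

end Elements

/-- Proper MT-morphisms: they map compact saturated elements to compact saturated elements. -/
def IsProper {M N : MTAlg.{u}} (f : M ⟶ N) : Prop :=
  ∀ a : M, M.IsCompact a → M.IsSaturated a →
    N.IsCompact (f.toHom a) ∧ N.IsSaturated (f.toHom a)

/-! ### The frame of open elements -/

section Opens

variable {M : MTAlg.{u}}

lemma isOpen_iff {a : M} : M.IsOpen a ↔ a ≤ M.box a :=
  ⟨le_of_eq, fun h => le_antisymm h (M.box_le a)⟩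

lemma isOpen_top : M.IsOpen ⊤ := M.box_top.symm

lemma isOpen_box (a : M) : M.IsOpen (M.box a) := isOpen_iff.2 (M.box_le_box_box a)

lemma isOpen_inf {a b : M} (ha : M.IsOpen a) (hb : M.IsOpen b) : M.IsOpen (a ⊓ b) := by
  unfold IsOpen at *
  rw [M.box_inf, ← ha, ← hb]

lemma isOpen_sSup {U : Set M} (h : ∀ u ∈ U, M.IsOpen u) : M.IsOpen (sSup U) :=
  isOpen_iff.2 (sSup_le fun u hu => (isOpen_iff.1 (h u hu)).trans (M.box_mono (le_sSup hu)))

lemma isOpen_map {N : MTAlg.{u}} (f : M ⟶ N) {a : M} (h : M.IsOpen a) : N.IsOpen (f.toHom a) :=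
  isOpen_iff.2 (by
    have := f.map_box_le a
    rwa [← h] at this)

variable (M) in
/-- The type of open elements, ordered as in `M`. -/
abbrev OpenElt : Type u := {a : M // M.IsOpen a}

/-- Joins and finite meets of open elements are those of `M`; the meet of a set is the interior of
its meet in `M`. -/
instance : CompleteLattice M.OpenElt where
  sup a b := ⟨a.1 ⊔ b.1, by
    have := isOpen_sSup (M := M) (U := {a.1, b.1}) (by
      rintro u (rfl | rfl)
      · exact a.2
      · exact b.2)
    rwa [sSup_pair] at this⟩
  le_sup_left a b := le_sup_left (a := a.1)
  le_sup_right a b := le_sup_right (a := a.1)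
  sup_le a b c h₁ h₂ := sup_le (a := a.1) h₁ h₂
  inf a b := ⟨a.1 ⊓ b.1, isOpen_inf a.2 b.2⟩
  inf_le_left a b := inf_le_left (a := a.1)
  inf_le_right a b := inf_le_right (a := a.1)
  le_inf a b c h₁ h₂ := le_inf (α := M) h₁ h₂
  sSup U := ⟨sSup (Subtype.val '' U), isOpen_sSup (by rintro _ ⟨u, -, rfl⟩; exact u.2)⟩
  isLUB_sSup U := ⟨fun u hu => le_sSup (α := M) ⟨u, hu, rfl⟩,
    fun _ h => sSup_le (α := M) (by rintro _ ⟨u, hu, rfl⟩; exact h hu)⟩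
  sInf U := ⟨M.box (sInf (Subtype.val '' U)), isOpen_box _⟩
  isGLB_sInf U := ⟨fun u hu => (M.box_le _).trans (sInf_le (α := M) ⟨u, hu, rfl⟩),
    fun a h => (isOpen_iff.1 a.2).trans (M.box_mono
      (le_sInf (α := M) (by rintro _ ⟨u, hu, rfl⟩; exact h hu)))⟩
  top := ⟨⊤, isOpen_top⟩
  bot := ⟨⊥, isOpen_iff.2 bot_le⟩
  le_top a := le_top (a := a.1)
  bot_le a := bot_le (a := a.1)

lemma coe_sSup_openElt (U : Set M.OpenElt) : (sSup U).1 = sSup (Subtype.val '' U) := rfl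

instance : Order.Frame M.OpenElt := Order.Frame.ofMinimalAxioms
  { inf_sSup_le_iSup_inf := fun a U => by
      change a.1 ⊓ sSup (Subtype.val '' U) ≤ (⨆ b ∈ U, a ⊓ b).1
      rw [inf_sSup_eq]
      refine iSup₂_le ?_
      rintro _ ⟨b, hb, rfl⟩
      exact (le_iSup₂ (f := fun b (_ : b ∈ U) => a ⊓ b) b hb : a ⊓ b ≤ _) }

end Opens

/-- The functor `𝒪` from MT-algebras to frames. -/
def openFunctor : MTAlg.{u} ⥤ Frm.{u} where
  obj M := Frm.of M.OpenElt
  map {M N} f := Frm.ofHom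
    { toFun := fun a => ⟨f.toHom a.1, isOpen_map f a.2⟩
      map_inf' := fun a b => Subtype.ext (map_inf f.toHom a.1 b.1)
      map_top' := Subtype.ext (map_top f.toHom)
      map_sSup' := fun U => Subtype.ext (by
        change f.toHom (sSup (Subtype.val '' U)) = sSup (Subtype.val '' _)
        rw [map_sSup, Set.image_image, Set.image_image]) }
  map_id _ := rfl
  map_comp _ _ := rfl

/-! ### The dual adjunction between MT-algebras and topological spaces -/

/-- The MT-algebra of all subsets of a topological space. -/
def powerset (X : Type u) [TopologicalSpace X] : MTAlg.{u} where
  carrier := Set X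
  box := interior
  box_top := interior_univ
  box_inf _ _ := interior_inter
  box_le _ := interior_subset
  box_le_box_box _ := interior_interior.ge

/-- The functor `𝒫`: `X ↦ (𝒫 X, int)`, `f ↦ f⁻¹`. -/
def powersetFunctor : TopCat.{u}ᵒᵖ ⥤ MTAlg.{u} where
  obj X := powerset X.unop
  map f :=
    { toHom := CompleteLatticeHom.setPreimage f.unop
      map_box_le := fun _ => preimage_interior_subset_interior_preimage f.unop.hom.continuous }
  map_id _ := rfl
  map_comp _ _ := rfl

/-- The type of atoms of `M`. -/
def Atoms (M : MTAlg.{u}) : Type u := {x : M // IsAtom x}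

/-- `η a` is the set of atoms below `a`. -/
def etaFun (M : MTAlg.{u}) (a : M) : Set M.Atoms := {x | x.1 ≤ a}

lemma etaFun_sSup (M : MTAlg.{u}) (U : Set M) : M.etaFun (sSup U) = sSup (M.etaFun '' U) := by
  ext x
  simp [etaFun, IsAtom.le_sSup x.2]

lemma etaFun_sInf (M : MTAlg.{u}) (U : Set M) : M.etaFun (sInf U) = sInf (M.etaFun '' U) := by
  ext x
  simp [etaFun]

/-- The open sets of atoms are the sets `η u` with `u` open. -/
instance (M : MTAlg.{u}) : TopologicalSpace M.Atoms where
  IsOpen A := ∃ u : M, M.IsOpen u ∧ A = M.etaFun u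
  isOpen_univ := ⟨⊤, isOpen_top, by ext x; simp [etaFun]⟩
  isOpen_inter := by
    rintro _ _ ⟨u, hu, rfl⟩ ⟨v, hv, rfl⟩
    exact ⟨u ⊓ v, isOpen_inf hu hv, by ext x; simp [etaFun]⟩
  isOpen_sUnion := by
    intro 𝒜 h
    refine ⟨sSup {u | M.IsOpen u ∧ M.etaFun u ∈ 𝒜}, isOpen_sSup fun u hu => hu.1, ?_⟩
    rw [etaFun_sSup]
    ext x
    constructor
    · rintro ⟨A, hA, hx⟩
      obtain ⟨u, hu, rfl⟩ := h A hA
      exact ⟨_, ⟨u, ⟨hu, hA⟩, rfl⟩, hx⟩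
    · rintro ⟨_, ⟨u, ⟨-, hA⟩, rfl⟩, hx⟩
      exact ⟨_, hA, hx⟩

/-- The left adjoint `f^*` of an MT-morphism `f`. -/
def leftAdj {M N : MTAlg.{u}} (f : M ⟶ N) (x : N) : M := sInf {a | x ≤ f.toHom a}

lemma leftAdj_le_iff {M N : MTAlg.{u}} (f : M ⟶ N) (x : N) (a : M) :
    leftAdj f x ≤ a ↔ x ≤ f.toHom a := by
  constructor
  · intro h
    refine le_trans ?_ (OrderHomClass.mono f.toHom h)
    rw [leftAdj, map_sInf]
    refine le_sInf ?_
    rintro _ ⟨b, hb, rfl⟩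
    exact hb
  · exact fun h => sInf_le h

lemma isAtom_leftAdj {M N : MTAlg.{u}} (f : M ⟶ N) {x : N} (hx : IsAtom x) :
    IsAtom (leftAdj f x) := by
  constructor
  · intro h
    have := (leftAdj_le_iff f x ⊥).1 h.le
    rw [map_bot] at this
    exact hx.1 (le_bot_iff.1 this)
  · intro b hb
    have h : x ≤ f.toHom b ⊔ f.toHom bᶜ := by
      rw [← map_sup, sup_compl_eq_top, map_top]
      exact le_top
    have h' : x ≤ f.toHom b ∨ x ≤ f.toHom bᶜ := by
      rw [← sSup_pair, IsAtom.le_sSup hx] at h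
      simpa using h
    rw [← leftAdj_le_iff, ← leftAdj_le_iff] at h'
    rcases h' with h | h
    · exact absurd h hb.not_ge
    · exact le_bot_iff.1 ((le_inf le_rfl (hb.le.trans h)).trans (inf_compl_eq_bot (a := b)).le)

/-- The continuous map between spaces of atoms given by the left adjoint of an MT-morphism. -/
def atMap {M N : MTAlg.{u}} (f : M ⟶ N) : C(N.Atoms, M.Atoms) where
  toFun x := ⟨leftAdj f x.1, isAtom_leftAdj f x.2⟩
  continuous_toFun := by
    refine ⟨?_⟩
    rintro _ ⟨u, hu, rfl⟩
    exact ⟨f.toHom u, isOpen_map f hu, by ext x; exact leftAdj_le_iff f x.1 u⟩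

/-- The functor `at`: `M` is mapped to the space of its atoms. -/
def atFunctor : MTAlg.{u} ⥤ TopCat.{u}ᵒᵖ where
  obj M := op (TopCat.of M.Atoms)
  map f := (TopCat.ofHom (atMap f)).op
  map_id M := congrArg Quiver.Hom.op (by
    ext x
    exact Subtype.ext (eq_of_forall_ge_iff fun a => leftAdj_le_iff (𝟙 M) x.1 a))
  map_comp {M N K} f g := congrArg Quiver.Hom.op (by
    ext x
    refine Subtype.ext (eq_of_forall_ge_iff fun a => ?_)
    change leftAdj (f ≫ g) x.1 ≤ a ↔ leftAdj f (leftAdj g x.1) ≤ a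
    simp only [leftAdj_le_iff, comp_toHom_apply])

/-- `η` as an MT-morphism `M ⟶ 𝒫 (at M)`. -/
def eta (M : MTAlg.{u}) : M ⟶ powerset M.Atoms where
  toHom :=
    { toFun := M.etaFun
      map_sSup' := M.etaFun_sSup
      map_sInf' := M.etaFun_sInf }
  map_box_le a := interior_maximal (fun _ hx => le_trans hx (M.box_le a))
    ⟨M.box a, isOpen_box a, rfl⟩

lemma isAtom_powerset_iff {X : Type u} [TopologicalSpace X] (A : powerset X) :
    IsAtom A ↔ ∃ x : X, A = ({x} : Set X) := Set.isAtom_iff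

/-- `ε` as a continuous map `X → at (𝒫 X)`, `x ↦ {x}`. -/
def epsilon (X : Type u) [TopologicalSpace X] : C(X, (powerset X).Atoms) where
  toFun x := ⟨({x} : Set X), (isAtom_powerset_iff _).2 ⟨x, rfl⟩⟩
  continuous_toFun := by
    refine ⟨?_⟩
    rintro _ ⟨u, hu, rfl⟩
    have h : _root_.IsOpen (show Set X from u) := by
      rw [← interior_eq_iff_isOpen]
      exact hu.symm
    convert h using 1
    ext x
    exact Set.singleton_subset_iff

/-- The dual adjunction between MT-algebras and topological spaces, with units `η` and `ε`. -/
def dualAdjunction : atFunctor.{u} ⊣ powersetFunctor.{u} := Adjunction.mkOfUnitCounit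
  { unit :=
      { app := eta
        naturality := fun M N f => hom_ext' fun a => by
          refine Set.ext fun x => ?_
          exact (leftAdj_le_iff f x.1 a).symm }
    counit :=
      { app := fun X => (TopCat.ofHom (epsilon X.unop)).op
        naturality := fun X Y f => congrArg Quiver.Hom.op (by
          ext y
          refine Subtype.ext (eq_of_forall_ge_iff fun a => ?_)
          exact (leftAdj_le_iff (powersetFunctor.map f) _ a).trans
            (Set.singleton_subset_iff.trans
              (Set.singleton_subset_iff (a := f.unop y) (s := (a : Set X.unop))).symm)) }
    left_triangle := by
      ext M
      refine congrArg Quiver.Hom.op ?_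
      ext x
      refine Subtype.ext (eq_of_forall_ge_iff fun a => ?_)
      exact (leftAdj_le_iff (eta M) _ a).trans Set.singleton_subset_iff
    right_triangle := by
      ext X
      refine hom_ext' fun a => ?_
      refine Set.ext fun x => ?_
      exact Set.singleton_subset_iff }

end MTAlg

/-! ## Continuous regular frames -/

/-- The way-below relation. -/
def WayBelow {L : Type u} [CompleteLattice L] (a b : L) : Prop :=
  ∀ S : Set L, b ≤ sSup S → ∃ T ⊆ S, T.Finite ∧ a ≤ sSup T

/-- Continuous frames. -/
def IsContinuousFrame (L : Type u) [Order.Frame L] : Prop :=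
  ∀ a : L, a = sSup {b | WayBelow b a}

/-- Regular frames: each `a` is the join of the `b` well inside `a`, that is, with `bᶜ ⊔ a = ⊤`,
where `bᶜ` is the pseudocomplement. -/
def IsRegularFrame (L : Type u) [Order.Frame L] : Prop :=
  ∀ a : L, a = sSup {b | bᶜ ⊔ a = ⊤}

/-- Proper frame homomorphisms: they preserve the way-below relation. -/
def IsProperFrameHom {L₁ L₂ : Frm.{u}} (f : L₁ ⟶ L₂) : Prop :=
  ∀ a b : L₁, WayBelow a b → WayBelow (f a) (f b)

/-- Saturated subsets of a space: the intersections of open sets. -/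
def IsSaturatedSet {X : Type u} [TopologicalSpace X] (K : Set X) : Prop :=
  ∃ U : Set (Set X), (∀ u ∈ U, IsOpen u) ∧ K = ⋂₀ U

/-- Proper maps: preimages of compact saturated sets are compact. -/
def IsProperTop {X Y : TopCat.{u}} (f : X ⟶ Y) : Prop :=
  ∀ K : Set Y, IsCompact K → IsSaturatedSet K → IsCompact (f ⁻¹' K)

/-! ## The three categories -/

/-- `LCHMT`: locally compact Hausdorff MT-algebras and proper MT-morphisms. -/
def LCHMT : Subcat MTAlg.{u} where
  obj M := M.IsLocallyCompact ∧ M.IsHausdorff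
  hom _ _ f := MTAlg.IsProper f
  id_mem _ := fun _ h₁ h₂ => ⟨h₁, h₂⟩
  comp_mem _ _ _ f _ hf hg := fun a h₁ h₂ =>
    hg (f.toHom a) (hf a h₁ h₂).1 (hf a h₁ h₂).2

/-- `CRegFrm`: continuous regular frames and proper frame homomorphisms. -/
def CRegFrm : Subcat Frm.{u} where
  obj L := IsContinuousFrame L ∧ IsRegularFrame L
  hom _ _ f := IsProperFrameHom f
  id_mem _ := fun _ _ h => h
  comp_mem _ _ _ f _ hf hg := fun a b h => hg (f a) (f b) (hf a b h)

/-- `LCHaus`: locally compact Hausdorff spaces and proper continuous maps. -/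
def LCHaus : Subcat TopCat.{u} where
  obj X := LocallyCompactSpace X ∧ T2Space X
  hom _ _ f := IsProperTop f
  id_mem _ := fun _ h _ => h
  comp_mem _ _ _ f g hf hg := fun K h₁ h₂ => hf (g ⁻¹' K) (hg K h₁ h₂) (by
    obtain ⟨U, hU, rfl⟩ := h₂
    refine ⟨(fun u => g ⁻¹' u) '' U, ?_, ?_⟩
    · rintro _ ⟨u, hu, rfl⟩
      exact (hU u hu).preimage g.hom.continuous
    · ext x
      simp)

end

/-! ## Locally compact Hausdorff MT-algebras are spatial and sober -/

namespace MTAlg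

variable {M : MTAlg.{u}}

/-! Atoms come from compactness. A Hausdorff algebra is join-generated by closed elements, so under
local compactness every nonzero element lies above a nonzero compact closed one. Zorn's lemma gives
a minimal nonzero closed element below that, and minimality makes it an atom
(`IsCompact.exists_isAtom_le`, `IsLocallyCompact.isSpatial`). Atoms can then be treated as points:
they are separated by disjoint open elements, which gives sobriety and makes compact elements
closed.

Spatiality makes `eta` an isomorphism, while `epsilon` is a homeomorphism for every space. The dual
equivalence therefore follows once `at` and `𝒫` are known to respect the two subcategories.

The functor `𝒪` is not inverted directly. A compact element lies between two opens exactly when one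
is way below the other (`IsLocallyCompact.inside_iff_wayBelow`), which matches both local
compactness and properness with their frame versions. The composite of `𝒫` and `𝒪` is isomorphic to
`Ω`. The latter is an equivalence because points of the open-set frame of a Hausdorff space are
points of the space (`exists_forall_mem_iff`) and a continuous regular frame has enough points
(`exists_point`). As `𝒫` and this composite are equivalences, so is `𝒪`. -/

lemma isClosed_iff_isOpen_compl {a : M} : M.IsClosed a ↔ M.IsOpen aᶜ := by
  unfold IsClosed IsOpen dia
  constructor
  · intro h
    nth_rw 1 [h]
    rw [compl_compl]
  · intro h
    rw [← h, compl_compl]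

lemma isClosed_compl_iff {a : M} : M.IsClosed aᶜ ↔ M.IsOpen a := by
  rw [isClosed_iff_isOpen_compl, compl_compl]

lemma isClosed_sInf {C : Set M} (h : ∀ c ∈ C, M.IsClosed c) : M.IsClosed (sInf C) := by
  rw [isClosed_iff_isOpen_compl, compl_sInf']
  refine isOpen_sSup ?_
  rintro _ ⟨c, hc, rfl⟩
  exact isClosed_iff_isOpen_compl.1 (h c hc)

lemma isClosed_inf {a b : M} (ha : M.IsClosed a) (hb : M.IsClosed b) : M.IsClosed (a ⊓ b) := by
  rw [← sInf_pair]
  exact isClosed_sInf (by rintro c (rfl | rfl) <;> assumption)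

lemma isClosed_dia (a : M) : M.IsClosed (M.dia a) :=
  isClosed_compl_iff.2 (isOpen_box _)

lemma le_dia (a : M) : a ≤ M.dia a := le_compl_comm.1 (M.box_le _)

lemma IsApproximated.isClosed {a : M} (h : M.IsApproximated a) : M.IsClosed a := by
  unfold IsApproximated at h
  rw [h]
  refine isClosed_sInf ?_
  rintro _ ⟨c, -, rfl⟩
  exact isClosed_dia _

/-! ### Join-generating classes and the `T₁` property -/

lemma JoinGenerates.mono {P Q : M → Prop} (h : M.JoinGenerates P) (hPQ : ∀ a, P a → Q a) :
    M.JoinGenerates Q := fun a => le_antisymm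
  ((h a).le.trans (sSup_le_sSup fun _ hc => ⟨hPQ _ hc.1, hc.2⟩)) (sSup_le fun _ hc => hc.2)

lemma JoinGenerates.exists_ne_bot {P : M → Prop} (h : M.JoinGenerates P) {a : M} (ha : a ≠ ⊥) :
    ∃ c, P c ∧ c ≤ a ∧ c ≠ ⊥ := by
  by_contra! H
  refine ha ((h a).trans (le_bot_iff.1 (sSup_le ?_)))
  rintro c ⟨hc, hca⟩
  exact (H c hc hca).le

/-- A nonzero member of the class below an atom must be the atom itself. -/
lemma JoinGenerates.of_isAtom {P : M → Prop} (h : M.JoinGenerates P) {x : M} (hx : IsAtom x) :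
    P x := by
  obtain ⟨c, hc, hcx, hc0⟩ := h.exists_ne_bot hx.1
  rwa [← (hx.le_iff.1 hcx).resolve_left hc0]

lemma IsHausdorff.joinGenerates_isClosed (h : M.IsHausdorff) : M.JoinGenerates M.IsClosed :=
  JoinGenerates.mono h fun _ => IsApproximated.isClosed

/-- Writing `aᶜ` as a join of closed elements writes `a` as a meet of opens. Hence the saturation
hypothesis in `IsProper` is automatic for `T₁` algebras. -/
lemma isSaturated_of_joinGenerates_isClosed (h : M.JoinGenerates M.IsClosed) (a : M) :
    M.IsSaturated a := by
  refine ⟨{u | M.IsOpen u ∧ a ≤ u}, fun u hu => hu.1, le_antisymm (le_sInf fun u hu => hu.2) ?_⟩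
  rw [← compl_le_compl_iff_le, h aᶜ]
  refine sSup_le fun c hc => le_compl_comm.1 (sInf_le ⟨isClosed_iff_isOpen_compl.1 hc.1, ?_⟩)
  exact le_compl_comm.1 hc.2

/-- Adding the open element `cᶜ` to a cover of `c` gives a cover of `k`; afterwards `cᶜ` can be
discarded. -/
lemma IsCompact.of_isClosed_le {k c : M} (hk : M.IsCompact k) (hc : M.IsClosed c) (h : c ≤ k) :
    M.IsCompact c := by
  intro U hU hcU
  have hk' : k ≤ sSup (insert cᶜ U) := by
    rw [sSup_insert]
    calc k ≤ ⊤ := le_top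
      _ = cᶜ ⊔ c := compl_sup_eq_top.symm
      _ ≤ _ := sup_le_sup_left hcU _
  obtain ⟨V, hVU, hV, hkV⟩ := hk (insert cᶜ U)
    (by
      rintro u (rfl | hu)
      · exact isClosed_iff_isOpen_compl.1 hc
      · exact hU u hu) hk'
  refine ⟨V \ {cᶜ}, fun v hv => (hVU hv.1).resolve_left hv.2, hV.subset Set.sdiff_subset, ?_⟩
  have : c ≤ cᶜ ⊔ sSup (V \ {cᶜ}) := by
    rw [← sSup_insert, Set.insert_sdiff_singleton]
    exact (h.trans hkV).trans (sSup_le_sSup (Set.subset_insert _ _))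
  calc c ≤ c ⊓ (cᶜ ⊔ sSup (V \ {cᶜ})) := le_inf le_rfl this
    _ = c ⊓ sSup (V \ {cᶜ}) := by rw [inf_sup_left, inf_compl_self, bot_sup_eq]
    _ ≤ _ := inf_le_right

lemma isCompact_bot : M.IsCompact ⊥ := fun _ _ _ => ⟨∅, by simp, by simp, bot_le⟩

lemma IsCompact.sup {a b : M} (ha : M.IsCompact a) (hb : M.IsCompact b) :
    M.IsCompact (a ⊔ b) := by
  intro U hU h
  obtain ⟨V, hV, hVf, hVa⟩ := ha U hU (le_sup_left.trans h)
  obtain ⟨W, hW, hWf, hWb⟩ := hb U hU (le_sup_right.trans h)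
  refine ⟨V ∪ W, Set.union_subset hV hW, hVf.union hWf, ?_⟩
  rw [sSup_union]
  exact sup_le_sup hVa hWb

/-- A nonempty chain of nonzero closed elements below a compact element has a nonzero meet. -/
lemma IsCompact.sInf_chain_ne_bot {k : M} (hk : M.IsCompact k) {C : Set M}
    (hC : ∀ c ∈ C, M.IsClosed c ∧ c ≠ ⊥ ∧ c ≤ k) (hchain : IsChain (· ≤ ·) C)
    (hne : C.Nonempty) : sInf C ≠ ⊥ := by
  intro h
  obtain ⟨V, hV, hVf, hkV⟩ := hk (compl '' C)
    (by
      rintro _ ⟨c, hc, rfl⟩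
      exact isClosed_iff_isOpen_compl.1 (hC c hc).1)
    (by rw [← compl_sInf', h, compl_bot]; exact le_top)
  -- The complements of a chain form a chain, so a finite family of them has an upper bound among
  -- them; `hne` serves the empty family.
  have key : ∃ c ∈ C, sSup V ≤ cᶜ := by
    clear hkV
    induction V, hVf using Set.Finite.induction_on with
    | empty =>
      obtain ⟨c, hc⟩ := hne
      exact ⟨c, hc, by simp⟩
    | @insert a s _ _ ih =>
      obtain ⟨c, hc, hsc⟩ := ih ((Set.subset_insert _ _).trans hV)
      obtain ⟨d, hd, rfl⟩ := hV (Set.mem_insert a s)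
      rw [sSup_insert]
      rcases hchain.total hc hd with hcd | hdc
      · exact ⟨c, hc, sup_le (compl_le_compl hcd) hsc⟩
      · exact ⟨d, hd, sup_le le_rfl (hsc.trans (compl_le_compl hdc))⟩
  obtain ⟨c, hc, hVc⟩ := key
  exact (hC c hc).2.1 (le_bot_iff.1 ((le_inf le_rfl
    (((hC c hc).2.2.trans hkV).trans hVc)).trans (inf_compl_self c).le))

/-- A nonzero compact closed element of a `T₁` MT-algebra has an atom below it. -/
lemma IsCompact.exists_isAtom_le (hT₁ : M.JoinGenerates M.IsClosed) {k : M} (hk : M.IsCompact k)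
    (hkc : M.IsClosed k) (h0 : k ≠ ⊥) : ∃ x : M, IsAtom x ∧ x ≤ k := by
  -- A maximal element in the order dual is a minimal nonzero closed element below `k`.
  obtain ⟨m, hmk, hm⟩ := zorn_le_nonempty₀ (α := Mᵒᵈ)
    {c | M.IsClosed (OrderDual.ofDual c) ∧ OrderDual.ofDual c ≠ ⊥ ∧ OrderDual.ofDual c ≤ k}
    (fun C hC hchain c hc =>
      ⟨OrderDual.toDual (sInf (OrderDual.ofDual '' C)),
        ⟨isClosed_sInf (by rintro _ ⟨d, hd, rfl⟩; exact (hC hd).1),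
          hk.sInf_chain_ne_bot (by rintro _ ⟨d, hd, rfl⟩; exact hC hd)
            (by
              rintro _ ⟨d, hd, rfl⟩ _ ⟨e, he, rfl⟩ hne
              exact (hchain hd he (fun h => hne (by rw [h]))).symm)
            ⟨_, c, hc, rfl⟩,
          (sInf_le (α := M) (Set.mem_image_of_mem _ hc)).trans (hC hc).2.2⟩,
        fun d hd => sInf_le (α := M) ⟨d, hd, rfl⟩⟩)
    (OrderDual.toDual k) ⟨hkc, h0, le_rfl⟩
  refine ⟨OrderDual.ofDual m, ⟨hm.prop.2.1, fun b hb => ?_⟩, hm.prop.2.2⟩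
  by_contra hb0
  -- A nonzero closed `c` below `b < m` would contradict the minimality of `m`.
  obtain ⟨c, hc, hcb, hc0⟩ := hT₁.exists_ne_bot hb0
  have : OrderDual.ofDual m ≤ c := hm.le_of_ge (y := OrderDual.toDual c)
    ⟨hc, hc0, (hcb.trans hb.le).trans hm.prop.2.2⟩ (hcb.trans hb.le : c ≤ OrderDual.ofDual m)
  exact hb.not_ge (this.trans hcb)

/-- The top is a join of opens lying below compact elements, so by distributivity `a` meets some
compact `k`. A nonzero closed element below `a ⊓ k` is again compact and has an atom below it. -/
lemma IsLocallyCompact.isSpatial (hLC : M.IsLocallyCompact) (hT₁ : M.JoinGenerates M.IsClosed) :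
    M.IsSpatial := by
  intro a ha
  have : ∃ k : M, M.IsCompact k ∧ a ⊓ k ≠ ⊥ := by
    by_contra! H
    refine ha ?_
    have h := hLC ⊤ isOpen_top
    rw [← inf_top_eq a, h, inf_sSup_eq]
    refine le_bot_iff.1 (iSup₂_le ?_)
    rintro v ⟨-, k, hk, hvk, -⟩
    exact (inf_le_inf_left a hvk).trans (H k hk).le
  obtain ⟨k, hk, hak⟩ := this
  obtain ⟨c, hc, hcak, hc0⟩ := hT₁.exists_ne_bot hak
  obtain ⟨x, hx, hxc⟩ :=
    (hk.of_isClosed_le hc (hcak.trans inf_le_right)).exists_isAtom_le hT₁ hc hc0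
  exact ⟨x, hx, hxc.trans (hcak.trans inf_le_left)⟩

lemma IsSpatial.le_of_forall_isAtom (h : M.IsSpatial) {a b : M}
    (H : ∀ x, IsAtom x → x ≤ a → x ≤ b) : a ≤ b := by
  by_contra hab
  have h0 : a ⊓ bᶜ ≠ ⊥ := fun h0 => hab (by rwa [← sdiff_eq, sdiff_eq_bot_iff] at h0)
  obtain ⟨x, hx, hxab⟩ := h _ h0
  refine hx.1 (le_bot_iff.1 ?_)
  rw [← inf_compl_self b]
  exact le_inf (H x hx (hxab.trans inf_le_left)) (hxab.trans inf_le_right)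

/-- Distinct atoms of a Hausdorff MT-algebra are separated by disjoint open elements. -/
lemma IsHausdorff.exists_isOpen_separating (h : M.IsHausdorff) {x y : M} (hx : IsAtom x)
    (hy : IsAtom y) (hxy : x ≠ y) :
    ∃ a b : M, M.IsOpen a ∧ M.IsOpen b ∧ x ≤ a ∧ y ≤ b ∧ a ⊓ b = ⊥ := by
  have hxa : M.IsApproximated x := JoinGenerates.of_isAtom h hx
  have : ∃ c : M, x ≤ M.box c ∧ ¬ y ≤ M.dia (M.box c) := by
    by_contra! H
    refine hxy (hx.le_iff_eq hy.1 |>.1 ?_).symm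
    unfold IsApproximated at hxa
    rw [hxa]
    refine le_sInf ?_
    rintro _ ⟨c, hc, rfl⟩
    exact H c hc
  obtain ⟨c, hxc, hyc⟩ := this
  refine ⟨M.box c, (M.dia (M.box c))ᶜ, isOpen_box c, isClosed_iff_isOpen_compl.1 (isClosed_dia _),
    hxc, ?_, ?_⟩
  · rw [le_compl_iff_disjoint_right]
    exact hy.not_le_iff_disjoint.1 hyc
  · exact le_bot_iff.1 ((inf_le_inf_right _ (le_dia _)).trans (inf_compl_self _).le)

/-- If an irreducible closed `p` had two atoms below it, disjoint opens `a`, `b` around them would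
split it into the proper closed parts `p ⊓ aᶜ` and `p ⊓ bᶜ`. So `p` is a closed atom, its own
closure. -/
lemma IsHausdorff.isSober (h : M.IsHausdorff) (hS : M.IsSpatial) : M.IsSober := by
  refine ⟨h.joinGenerates_isClosed.mono fun c hc =>
    ⟨⊤, c, isSaturated_of_joinGenerates_isClosed h.joinGenerates_isClosed ⊤, hc,
      (top_inf_eq c).symm⟩, ?_⟩
  intro p hp hp0 hirr
  obtain ⟨x, hx, hxp⟩ := hS p hp0
  have hpx : p = x := by
    refine le_antisymm (hS.le_of_forall_isAtom fun y hy hyp => ?_) hxp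
    by_contra hyx
    obtain ⟨a, b, ha, hb, hxa, hyb, hab⟩ := h.exists_isOpen_separating hx hy
      (fun e => hyx e.ge)
    have hcov : p = p ⊓ aᶜ ⊔ p ⊓ bᶜ := by
      rw [← inf_sup_left, ← compl_inf, hab, compl_bot, inf_top_eq]
    have aux : ∀ {z c : M}, IsAtom z → z ≤ p → z ≤ c → p = p ⊓ cᶜ → False := by
      intro z c hz hzp hzc hpc
      refine hz.1 (le_bot_iff.1 ?_)
      rw [← inf_compl_self c]
      exact le_inf hzc (hzp.trans (hpc.le.trans inf_le_right))
    rcases hirr _ _ (isClosed_inf hp (isClosed_compl_iff.2 ha))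
      (isClosed_inf hp (isClosed_compl_iff.2 hb)) hcov with hpa | hpb
    · exact aux hx hxp hxa hpa
    · exact aux hy hyp hyb hpb
  refine ⟨x, hx, ?_⟩
  rw [← hpx]
  exact hp

/-- Compact elements of a spatial Hausdorff MT-algebra are closed. -/
lemma IsHausdorff.isClosed_of_isCompact (h : M.IsHausdorff) (hS : M.IsSpatial) {k : M}
    (hk : M.IsCompact k) : M.IsClosed k := by
  rw [isClosed_iff_isOpen_compl, isOpen_iff]
  refine hS.le_of_forall_isAtom fun y hy hyk => ?_
  -- The cover consists of the opens whose exterior contains `y`; the exterior of a finite join is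
  -- the meet of the exteriors, so it still contains `y`.
  obtain ⟨V, hV, hVf, hkV⟩ := hk {a | M.IsOpen a ∧ y ≤ M.box aᶜ} (fun a ha => ha.1)
    (hS.le_of_forall_isAtom fun x hx hxk => by
      obtain ⟨a, b, ha, hb, hxa, hyb, hab⟩ := h.exists_isOpen_separating hx hy (by
        rintro rfl
        exact hx.1 (le_bot_iff.1 ((le_inf hxk hyk).trans (inf_compl_self k).le)))
      refine hxa.trans (le_sSup ⟨ha, hyb.trans ((isOpen_iff.1 hb).trans (M.box_mono ?_))⟩)
      rw [le_compl_iff_disjoint_left, disjoint_iff]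
      exact hab)
  refine le_trans ?_ (M.box_mono (compl_le_compl hkV))
  clear hkV
  induction V, hVf using Set.Finite.induction_on with
  | empty => simp [M.box_top]
  | @insert a s _ _ ih =>
    rw [sSup_insert, compl_sup, M.box_inf]
    exact le_inf (hV (Set.mem_insert a s)).2 (ih ((Set.subset_insert _ _).trans hV))

end MTAlg

/-! ## The space of atoms of a locally compact Hausdorff MT-algebra -/

namespace MTAlg

variable {M : MTAlg.{u}}

/-- In a spatial MT-algebra, `η` is an order isomorphism onto the subsets of the set of atoms. -/
noncomputable def IsSpatial.etaIso (h : M.IsSpatial) : M ≃o Set M.Atoms where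
  toFun := M.etaFun
  invFun A := sSup (Subtype.val '' A)
  left_inv a := le_antisymm (sSup_le (by rintro _ ⟨x, hx, rfl⟩; exact hx))
    (h.le_of_forall_isAtom fun x hx hxa => le_sSup ⟨⟨x, hx⟩, hxa, rfl⟩)
  right_inv A := by
    ext x
    change x.1 ≤ sSup _ ↔ x ∈ A
    rw [IsAtom.le_sSup x.2]
    constructor
    · rintro ⟨_, ⟨y, hy, rfl⟩, hxy⟩
      rwa [Subtype.ext ((y.2.le_iff_eq x.2.1).1 hxy)]
    · exact fun hx => ⟨_, ⟨x, hx, rfl⟩, le_rfl⟩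
  map_rel_iff' {a b} := ⟨fun H => h.le_of_forall_isAtom fun x hx hxa => @H ⟨x, hx⟩ hxa,
    fun H _ hx => le_trans hx H⟩

lemma IsSpatial.etaFun_subset_iff (h : M.IsSpatial) {a b : M} :
    M.etaFun a ⊆ M.etaFun b ↔ a ≤ b := h.etaIso.le_iff_le

lemma IsSpatial.isOpen_etaFun_iff (h : M.IsSpatial) {a : M} :
    _root_.IsOpen (M.etaFun a) ↔ M.IsOpen a := by
  constructor
  · rintro ⟨u, hu, hau⟩
    rwa [h.etaIso.injective hau]
  · exact fun ha => ⟨a, ha, rfl⟩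

/-! ### Topological notions read in the powerset algebra, and transport along isomorphisms -/

lemma isOpen_powerset_iff {X : Type u} [TopologicalSpace X] {A : Set X} :
    (powerset X).IsOpen A ↔ _root_.IsOpen A :=
  eq_comm.trans interior_eq_iff_isOpen

lemma isCompact_powerset_iff {X : Type u} [TopologicalSpace X] {A : Set X} :
    (powerset X).IsCompact A ↔ _root_.IsCompact A := by
  constructor
  · intro h
    refine isCompact_of_finite_subcover fun {ι} U hU hA => ?_
    obtain ⟨V, hV, hVf, hAV⟩ := h (Set.range U)
      (by
        rintro _ ⟨i, rfl⟩
        exact isOpen_powerset_iff.2 (hU i))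
      (hA : A ⊆ ⋃₀ Set.range U)
    obtain ⟨t, -, ht⟩ := (Set.exists_subset_image_finite_and (s := Set.univ) (f := U)
      (p := fun W => W = V)).1 ⟨V, by rwa [Set.image_univ], hVf, rfl⟩
    refine ⟨ht.1.toFinset, ?_⟩
    have hAV' : A ⊆ ⋃₀ V := hAV
    rw [← ht.2] at hAV'
    simpa using hAV'
  · intro h (U : Set (Set X)) hU (hA : A ⊆ ⋃₀ U)
    obtain ⟨V, hV, hVf, hAV⟩ := h.elim_finite_subcover_image (b := U) (c := id)
      (fun u hu => isOpen_powerset_iff.1 (hU u hu))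
      (by rwa [Set.sUnion_eq_biUnion] at hA)
    exact ⟨V, hV, hVf, hAV.trans (Set.sUnion_eq_biUnion (s := V)).ge⟩

lemma isSaturated_powerset_iff {X : Type u} [TopologicalSpace X] {A : Set X} :
    (powerset X).IsSaturated A ↔ IsSaturatedSet A :=
  exists_congr fun _ => and_congr_left' (forall₂_congr fun _ _ => isOpen_powerset_iff)

/-- In a spatial MT-algebra, `η` is an isomorphism of MT-algebras. -/
noncomputable def IsSpatial.etaInv (h : M.IsSpatial) : powerset M.Atoms ⟶ M where
  toHom :=
    { toFun := h.etaIso.symm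
      map_sSup' := fun S => (h.etaIso.symm.map_sSup S).trans sSup_image.symm
      map_sInf' := fun S => (h.etaIso.symm.map_sInf S).trans sInf_image.symm }
  map_box_le A := by
    change h.etaIso.symm (interior A) ≤ M.box (h.etaIso.symm A)
    have hA : M.IsOpen (h.etaIso.symm (interior A)) := by
      rw [← h.isOpen_etaFun_iff]
      change _root_.IsOpen (h.etaIso (h.etaIso.symm (interior A)))
      rw [OrderIso.apply_symm_apply]
      exact isOpen_interior
    exact (isOpen_iff.1 hA).trans (M.box_mono (h.etaIso.symm.monotone interior_subset))

lemma IsSpatial.eta_etaInv (h : M.IsSpatial) : eta M ≫ h.etaInv = 𝟙 M :=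
  hom_ext' fun a => h.etaIso.symm_apply_apply a

lemma IsSpatial.etaInv_eta (h : M.IsSpatial) : h.etaInv ≫ eta M = 𝟙 _ :=
  hom_ext' fun A => h.etaIso.apply_symm_apply A

/-- Isomorphisms of MT-algebras preserve compact elements. -/
lemma IsCompact.map {N : MTAlg.{u}} (f : M ⟶ N) (g : N ⟶ M) (hfg : f ≫ g = 𝟙 M)
    (hgf : g ≫ f = 𝟙 N) {a : M} (ha : M.IsCompact a) : N.IsCompact (f.toHom a) := by
  have hf : ∀ a, g.toHom (f.toHom a) = a := fun a => by
    rw [← comp_toHom_apply, hfg, id_toHom_apply]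
  have hg : ∀ b, f.toHom (g.toHom b) = b := fun b => by
    rw [← comp_toHom_apply, hgf, id_toHom_apply]
  intro U hU haU
  obtain ⟨V, hV, hVf, haV⟩ := ha (g.toHom '' U)
    (by
      rintro _ ⟨u, hu, rfl⟩
      exact isOpen_map g (hU u hu))
    (by
      rw [← map_sSup, ← hf a]
      exact OrderHomClass.mono g.toHom haU)
  refine ⟨f.toHom '' V, ?_, hVf.image _, ?_⟩
  · rintro _ ⟨v, hv, rfl⟩
    obtain ⟨u, hu, rfl⟩ := hV hv
    rwa [hg]
  · rw [← map_sSup]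
    exact OrderHomClass.mono f.toHom haV

/-- Any MT-morphism preserves meets and openness, so properness only constrains compactness. -/
lemma IsSaturated.map {N : MTAlg.{u}} (f : M ⟶ N) {a : M} (ha : M.IsSaturated a) :
    N.IsSaturated (f.toHom a) := by
  obtain ⟨U, hU, rfl⟩ := ha
  refine ⟨f.toHom '' U, ?_, map_sInf f.toHom U⟩
  rintro _ ⟨u, hu, rfl⟩
  exact isOpen_map f (hU u hu)

lemma isProper_of_iso {N : MTAlg.{u}} (f : M ⟶ N) (g : N ⟶ M) (hfg : f ≫ g = 𝟙 M)
    (hgf : g ≫ f = 𝟙 N) : IsProper f :=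
  fun _ ha hs => ⟨ha.map f g hfg hgf, hs.map f⟩

lemma IsSpatial.isCompact_etaFun_iff (h : M.IsSpatial) {a : M} :
    _root_.IsCompact (M.etaFun a) ↔ M.IsCompact a := by
  rw [← isCompact_powerset_iff]
  refine ⟨fun ha => ?_, fun ha => ha.map (eta M) h.etaInv h.eta_etaInv h.etaInv_eta⟩
  have := ha.map h.etaInv (eta M) h.etaInv_eta h.eta_etaInv
  exact (h.etaIso.symm_apply_apply a) ▸ this

lemma IsHausdorff.t2Space_atoms (h : M.IsHausdorff) : T2Space M.Atoms where
  t2 x y hxy := by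
    obtain ⟨a, b, ha, hb, hxa, hyb, hab⟩ :=
      h.exists_isOpen_separating x.2 y.2 fun e => hxy (Subtype.ext e)
    refine ⟨M.etaFun a, M.etaFun b, ⟨a, ha, rfl⟩, ⟨b, hb, rfl⟩, hxa, hyb, ?_⟩
    rw [Set.disjoint_left]
    exact fun z hza hzb => z.2.1 (le_bot_iff.1 ((le_inf hza hzb).trans hab.le))

/-- One compact neighbourhood per point suffices, since Hausdorffness upgrades it to full local
compactness; hence only the top element is used. -/
lemma IsLocallyCompact.weaklyLocallyCompactSpace_atoms (h : M.IsLocallyCompact)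
    (hS : M.IsSpatial) : WeaklyLocallyCompactSpace M.Atoms where
  exists_compact_mem_nhds x := by
    have hx : x.1 ≤ ⊤ := le_top
    rw [h ⊤ isOpen_top, IsAtom.le_sSup x.2] at hx
    obtain ⟨v, ⟨hv, k, hk, hvk, -⟩, hxv⟩ := hx
    exact ⟨M.etaFun k, hS.isCompact_etaFun_iff.2 hk,
      mem_nhds_iff.2 ⟨M.etaFun v, hS.etaFun_subset_iff.2 hvk, ⟨v, hv, rfl⟩, hxv⟩⟩

lemma isSpatial_of_LCHMT (h : LCHMT.obj M) : M.IsSpatial :=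
  h.1.isSpatial h.2.joinGenerates_isClosed

lemma restrictsToOp_atFunctor : Subcat.RestrictsToOp atFunctor.{u} LCHMT LCHaus where
  obj M h := by
    have hT₂ := h.2.t2Space_atoms
    have := h.1.weaklyLocallyCompactSpace_atoms (isSpatial_of_LCHMT h)
    exact ⟨(inferInstance : LocallyCompactSpace M.Atoms), hT₂⟩
  map {M N} f hM hN hf := by
    intro K hK _
    obtain ⟨a, rfl⟩ := (isSpatial_of_LCHMT hM).etaIso.surjective K
    have hfa := (hf a ((isSpatial_of_LCHMT hM).isCompact_etaFun_iff.1 hK)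
      (isSaturated_of_joinGenerates_isClosed hM.2.joinGenerates_isClosed a)).1
    -- By spatiality `K` is some `η a`, and the adjunction `leftAdj f ⊣ f` turns its preimage into
    -- `η (f a)`.
    have hpre : atMap f ⁻¹' M.etaFun a = N.etaFun (f.toHom a) :=
      Set.ext fun x => leftAdj_le_iff f x.1 a
    have := (isSpatial_of_LCHMT hN).isCompact_etaFun_iff.2 hfa
    rwa [← hpre] at this

/-! ## The MT-algebra of subsets of a locally compact Hausdorff space -/

/-- Singletons are approximated: if `y ≠ x`, some open neighbourhood of `x` has a closure missing
`y`. -/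
lemma isHausdorff_powerset (X : Type u) [TopologicalSpace X] [T2Space X] :
    (powerset X).IsHausdorff := by
  intro (A : Set X)
  refine le_antisymm (fun x hx => ?_) (sSup_le fun c hc => hc.2)
  refine Set.mem_sUnion.2 ⟨{x}, ⟨?_, Set.singleton_subset_iff.2 hx⟩, rfl⟩
  refine le_antisymm (le_sInf ?_) fun y hy => ?_
  · rintro _ ⟨c, hc, rfl⟩
    exact le_trans hc (le_dia (M := powerset X) _)
  · by_contra hyx
    obtain ⟨U, V, hU, hV, hxU, hyV, hUV⟩ := t2_separation (fun e : x = y => hyx e.symm)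
    have hmem := Set.mem_sInter.1 hy _ ⟨U, Set.singleton_subset_iff.2
      (by rwa [show (powerset X).box U = U from hU.interior_eq]), rfl⟩
    have hVU : V ⊆ (interior U)ᶜ := fun z hzV hzU =>
      Set.disjoint_left.1 hUV (interior_subset hzU) hzV
    exact hmem (interior_maximal hVU hV hyV)

lemma isLocallyCompact_powerset (X : Type u) [TopologicalSpace X] [LocallyCompactSpace X] :
    (powerset X).IsLocallyCompact := by
  intro (A : Set X) hA
  refine le_antisymm (fun x hx => ?_) (sSup_le fun c ⟨_, _, _, h₁, h₂⟩ => h₁.trans h₂)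
  obtain ⟨K, hKx, hKA, hK⟩ := local_compact_nhds ((isOpen_powerset_iff.1 hA).mem_nhds hx)
  exact Set.mem_sUnion.2 ⟨interior K, ⟨isOpen_powerset_iff.2 isOpen_interior, K,
    isCompact_powerset_iff.2 hK, interior_subset, hKA⟩, mem_interior_iff_mem_nhds.2 hKx⟩

lemma restrictsOfOp_powersetFunctor :
    Subcat.RestrictsOfOp powersetFunctor.{u} LCHaus LCHMT where
  obj X h := by
    obtain ⟨_, _⟩ := h
    exact ⟨isLocallyCompact_powerset X, isHausdorff_powerset X⟩
  map {X Y} f _ _ hf := fun A hA hs =>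
    ⟨isCompact_powerset_iff.2 (hf A (isCompact_powerset_iff.1 hA) (isSaturated_powerset_iff.1 hs)),
      hs.map _⟩

/-- For a topological space, `ε` is a homeomorphism. -/
noncomputable def epsilonHomeomorph (X : Type u) [TopologicalSpace X] :
    X ≃ₜ (powerset X).Atoms :=
  (Equiv.ofBijective (epsilon X) ⟨fun _ _ h => Set.singleton_injective (congrArg Subtype.val h),
    fun A => by
      obtain ⟨x, hx⟩ := (isAtom_powerset_iff A.1).1 A.2
      exact ⟨x, Subtype.ext hx.symm⟩⟩).toHomeomorphOfContinuousOpen (epsilon X).continuous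
    (fun U hU => ⟨U, isOpen_powerset_iff.2 hU, by
      ext A
      obtain ⟨x, hx⟩ := (isAtom_powerset_iff A.1).1 A.2
      obtain rfl : A = epsilon X x := Subtype.ext hx
      constructor
      · rintro ⟨y, hy, hyx⟩
        obtain rfl : y = x := Set.singleton_injective (congrArg Subtype.val hyx)
        exact Set.singleton_subset_iff.2 hy
      · exact fun h => ⟨x, Set.singleton_subset_iff.1 h, rfl⟩⟩)

lemma isProperTop_iso {X Y : TopCat.{u}} (e : X ≅ Y) : IsProperTop e.hom :=
  fun _ hK _ => (TopCat.homeoOfIso e).isCompact_preimage.2 hK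

/-! ## The dual equivalence between `LCHMT` and `LCHaus` -/

noncomputable def unitIso : 𝟭 LCHMT.{u}.Cat ≅
    restrictsToOp_atFunctor.functor ⋙ restrictsOfOp_powersetFunctor.functor :=
  NatIso.ofComponents
    (fun M =>
      have h := isSpatial_of_LCHMT M.property
      { hom := ⟨eta M.val, isProper_of_iso _ h.etaInv h.eta_etaInv h.etaInv_eta⟩
        inv := ⟨h.etaInv, isProper_of_iso _ (eta M.val) h.etaInv_eta h.eta_etaInv⟩
        hom_inv_id := Subcat.Hom.ext h.eta_etaInv
        inv_hom_id := Subcat.Hom.ext h.etaInv_eta })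
    (fun f => Subcat.Hom.ext (dualAdjunction.unit.naturality f.val))

noncomputable def counitIso :
    restrictsOfOp_powersetFunctor.functor ⋙ restrictsToOp_atFunctor.functor ≅
      𝟭 LCHaus.{u}.Catᵒᵖ :=
  NatIso.ofComponents
    (fun X =>
      letI e := TopCat.isoOfHomeo (X := X.unop.val)
        (Y := TopCat.of (powerset X.unop.val).Atoms) (epsilonHomeomorph X.unop.val)
      Iso.op (X := X.unop)
      (Y := ((restrictsOfOp_powersetFunctor.functor ⋙ restrictsToOp_atFunctor.functor).obj X).unop)
      { hom := ⟨e.hom, isProperTop_iso e⟩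
        inv := ⟨e.inv, isProperTop_iso e.symm⟩
        hom_inv_id := Subcat.Hom.ext e.hom_inv_id
        inv_hom_id := Subcat.Hom.ext e.inv_hom_id })
    (fun f => congrArg Quiver.Hom.op (Subcat.Hom.ext
      (congrArg Quiver.Hom.unop (dualAdjunction.counit.naturality f.unop.val.op))))

lemma restrictsToDualEquivalence : Subcat.RestrictsToDualEquivalence dualAdjunction.{u}
    restrictsToOp_atFunctor restrictsOfOp_powersetFunctor :=
  ⟨unitIso, counitIso, fun _ => rfl, fun _ => rfl⟩

/-- Two natural isomorphisms suffice: `Equivalence.mk` adjusts one of them to obtain the triangle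
identity. -/
lemma isEquivalence_powersetFunctor :
    restrictsOfOp_powersetFunctor.{u}.functor.IsEquivalence :=
  (CategoryTheory.Equivalence.mk _ _ unitIso counitIso).isEquivalence_inverse

end MTAlg

/-! ## The way-below relation -/

section WayBelow

variable {L L' : Type u}

lemma WayBelow.le [CompleteLattice L] {a b : L} (h : WayBelow a b) : a ≤ b := by
  obtain ⟨T, hT, -, haT⟩ := h {b} (by simp)
  exact haT.trans ((sSup_le_sSup hT).trans (by simp))

lemma WayBelow.map_orderIso [CompleteLattice L] [CompleteLattice L'] (e : L ≃o L') {a b : L}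
    (h : WayBelow a b) : WayBelow (e a) (e b) := by
  intro S hS
  obtain ⟨T, hT, hTf, haT⟩ := h (e.symm '' S) (by
    rw [sSup_image, ← e.symm.map_sSup]
    exact e.le_symm_apply.2 hS)
  refine ⟨e '' T, ?_, hTf.image _, ?_⟩
  · rintro _ ⟨t, ht, rfl⟩
    obtain ⟨s, hs, rfl⟩ := hT ht
    rwa [e.apply_symm_apply]
  · rw [sSup_image, ← e.map_sSup]
    exact e.monotone haT

lemma wayBelow_orderIso_iff [CompleteLattice L] [CompleteLattice L'] (e : L ≃o L') {a b : L} :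
    WayBelow (e a) (e b) ↔ WayBelow a b :=
  ⟨fun h => by simpa using h.map_orderIso e.symm, fun h => h.map_orderIso e⟩

lemma IsContinuousFrame.of_orderIso [Order.Frame L] [Order.Frame L'] (e : L ≃o L')
    (h : IsContinuousFrame L) : IsContinuousFrame L' := by
  intro a
  refine le_antisymm ?_ (sSup_le fun b hb => WayBelow.le hb)
  rw [← e.symm.le_iff_le]
  refine (h (e.symm a)).le.trans (sSup_le fun b hb => e.le_symm_apply.2 (le_sSup ?_))
  simpa using WayBelow.map_orderIso e hb

lemma IsRegularFrame.of_orderIso [Order.Frame L] [Order.Frame L'] (e : L ≃o L')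
    (h : IsRegularFrame L) : IsRegularFrame L' := by
  have hinside : ∀ a b : L', bᶜ ⊔ a = ⊤ → b ≤ a := fun a b hb =>
    calc b = b ⊓ (bᶜ ⊔ a) := by rw [hb, inf_top_eq]
      _ = b ⊓ a := by rw [inf_sup_left, inf_compl_self, bot_sup_eq]
      _ ≤ a := inf_le_right
  intro a
  refine le_antisymm ?_ (sSup_le (hinside a))
  rw [← e.symm.le_iff_le]
  refine (h (e.symm a)).le.trans (sSup_le fun b hb => e.le_symm_apply.2 (le_sSup ?_))
  have hb' := congrArg e (hb : bᶜ ⊔ e.symm a = ⊤)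
  rw [map_sup, map_top, e.apply_symm_apply] at hb'
  -- It is enough that `e bᶜ ≤ (e b)ᶜ`, which is disjointness of `e bᶜ` and `e b`.
  refine top_le_iff.1 (hb'.ge.trans (sup_le_sup_right ?_ a))
  rw [le_compl_iff_disjoint_right, disjoint_iff, ← map_inf, compl_inf_self, map_bot]

end WayBelow

/-! ## The frame of open elements of a locally compact Hausdorff MT-algebra -/

namespace MTAlg

variable {M : MTAlg.{u}}

lemma wayBelow_of_inside {a b : M.OpenElt} (h : M.Inside a.1 b.1) : WayBelow a b := by
  obtain ⟨k, hk, hak, hkb⟩ := h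
  intro S hS
  obtain ⟨V, hV, hVf, hkV⟩ := hk (Subtype.val '' S) (by rintro _ ⟨u, -, rfl⟩; exact u.2)
    (hkb.trans hS)
  obtain ⟨T, hTS, hTf, rfl⟩ := (Set.exists_subset_image_finite_and (p := fun W => W = V)).1
    ⟨V, hV, hVf, rfl⟩
  exact ⟨T, hTS, hTf, hak.trans hkV⟩

/-- For the converse, the opens inside `b` cover `b`, so finitely many cover `a`; the join of their
compact witnesses is compact and lies between `a` and `b`. -/
lemma IsLocallyCompact.inside_iff_wayBelow (hM : M.IsLocallyCompact) {a b : M.OpenElt} :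
    M.Inside a.1 b.1 ↔ WayBelow a b := by
  refine ⟨wayBelow_of_inside, fun h => ?_⟩
  obtain ⟨T, hT, hTf, haT⟩ := h {c | M.Inside c.1 b.1} (by
    change b.1 ≤ _
    refine (hM b.1 b.2).le.trans (sSup_le fun c hc => le_sSup ⟨⟨c, hc.1⟩, hc.2, rfl⟩))
  have key : M.Inside (sSup T).1 b.1 := by
    clear haT
    induction T, hTf using Set.Finite.induction_on with
    | empty => exact ⟨⊥, isCompact_bot, (congrArg Subtype.val sSup_empty).le, bot_le⟩
    | @insert c s _ _ ih =>
      obtain ⟨k, hk, hck, hkb⟩ := hT (Set.mem_insert c s)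
      obtain ⟨l, hl, hsl, hlb⟩ := ih ((Set.subset_insert _ _).trans hT)
      rw [sSup_insert]
      exact ⟨k ⊔ l, hk.sup hl, sup_le_sup hck hsl, sup_le hkb hlb⟩
  obtain ⟨k, hk, hTk, hkb⟩ := key
  exact ⟨k, hk, le_trans haT hTk, hkb⟩

lemma IsLocallyCompact.isContinuousFrame (hM : M.IsLocallyCompact) :
    IsContinuousFrame M.OpenElt := by
  intro a
  refine le_antisymm ?_ (sSup_le fun b hb => WayBelow.le hb)
  change a.1 ≤ _
  rw [hM a.1 a.2]
  exact sSup_le fun b hb => le_sSup ⟨⟨b, hb.1⟩, wayBelow_of_inside hb.2, rfl⟩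

/-- Local compactness writes `a` as a join of opens `b ≤ k ≤ a` with `k` compact, hence closed. The
open element `kᶜ` is disjoint from `b` and joins with `a` to the top. -/
lemma isRegularFrame_of_LCHMT (h : LCHMT.obj M) : IsRegularFrame M.OpenElt := by
  intro a
  refine le_antisymm ?_ (sSup_le fun b (hb : bᶜ ⊔ a = ⊤) =>
    calc b = b ⊓ (bᶜ ⊔ a) := by rw [hb, inf_top_eq]
      _ = b ⊓ a := by rw [inf_sup_left, inf_compl_self, bot_sup_eq]
      _ ≤ a := inf_le_right)
  change a.1 ≤ _
  rw [h.1 a.1 a.2]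
  refine sSup_le fun b ⟨hb, k, hk, hbk, hka⟩ => le_sSup ⟨⟨b, hb⟩, ?_, rfl⟩
  let c : M.OpenElt := ⟨kᶜ, isClosed_iff_isOpen_compl.1
    (h.2.isClosed_of_isCompact (isSpatial_of_LCHMT h) hk)⟩
  have hcb : c ≤ (⟨b, hb⟩ : M.OpenElt)ᶜ := by
    rw [le_compl_iff_disjoint_right, disjoint_iff_inf_le]
    exact (inf_le_inf_left kᶜ hbk).trans (compl_inf_self k).le
  have hca : (⊤ : M.OpenElt) ≤ c ⊔ a :=
    (compl_sup_eq_top (x := k)).ge.trans (sup_le_sup_left hka kᶜ)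
  exact top_le_iff.1 (hca.trans (sup_le_sup_right hcb a))

lemma restricts_openFunctor : Subcat.Restricts openFunctor.{u} LCHMT CRegFrm where
  obj _ h := ⟨h.1.isContinuousFrame, isRegularFrame_of_LCHMT h⟩
  map {M N} f hM _ hf := by
    intro a b hab
    obtain ⟨k, hk, hak, hkb⟩ := hM.1.inside_iff_wayBelow.2 hab
    exact wayBelow_of_inside ⟨f.toHom k,
      (hf k hk (isSaturated_of_joinGenerates_isClosed hM.2.joinGenerates_isClosed k)).1,
      OrderHomClass.mono f.toHom hak, OrderHomClass.mono f.toHom hkb⟩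

/-! ## The frame of open sets of a locally compact Hausdorff space -/

/-- The open elements of `𝒫 X` are the open sets of `X`. -/
def openEltPowersetIso (X : Type u) [TopologicalSpace X] :
    (powerset X).OpenElt ≃o TopologicalSpace.Opens X where
  toFun a := ⟨a.1, isOpen_powerset_iff.1 a.2⟩
  invFun U := ⟨U.1, isOpen_powerset_iff.2 U.2⟩
  left_inv _ := rfl
  right_inv _ := rfl
  map_rel_iff' := Iff.rfl

end MTAlg

open MTAlg TopologicalSpace

lemma restrictsOfOp_topCatOpToFrm : Subcat.RestrictsOfOp topCatOpToFrm.{u} LCHaus CRegFrm where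
  obj X h := by
    have h' := restricts_openFunctor.obj _ (restrictsOfOp_powersetFunctor.obj X h)
    exact ⟨h'.1.of_orderIso (openEltPowersetIso X), h'.2.of_orderIso (openEltPowersetIso X)⟩
  map {X Y} f hX hY hf := by
    intro a b hab
    have h' := restricts_openFunctor.map _ (restrictsOfOp_powersetFunctor.obj Y hY)
      (restrictsOfOp_powersetFunctor.obj X hX) (restrictsOfOp_powersetFunctor.map f hX hY hf)
      _ _ (hab.map_orderIso (openEltPowersetIso Y).symm)
    exact h'.map_orderIso (openEltPowersetIso X)

lemma wayBelow_opens_iff {X : Type u} [TopologicalSpace X] [LocallyCompactSpace X]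
    {U V : Opens X} : WayBelow U V ↔ ∃ K : Set X, IsCompact K ∧ (U : Set X) ⊆ K ∧ K ⊆ V := by
  rw [← wayBelow_orderIso_iff (openEltPowersetIso X).symm,
    ← (isLocallyCompact_powerset X).inside_iff_wayBelow]
  exact exists_congr fun K => and_congr_left' isCompact_powerset_iff

/-- The frame of open elements of `𝒫 X` is naturally isomorphic to the frame of open sets. -/
noncomputable def powersetOpenIso :
    restrictsOfOp_powersetFunctor.functor ⋙ restricts_openFunctor.functor ≅
      restrictsOfOp_topCatOpToFrm.{u}.functor :=
  NatIso.ofComponents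
    (fun X =>
      letI e := Frm.Iso.mk (α := Frm.of (powerset X.unop.val).OpenElt)
        (β := Frm.of (Opens X.unop.val)) (openEltPowersetIso X.unop.val)
      { hom := ⟨e.hom, fun _ _ h => h.map_orderIso (openEltPowersetIso X.unop.val)⟩
        inv := ⟨e.inv, fun _ _ h => h.map_orderIso (openEltPowersetIso X.unop.val).symm⟩
        hom_inv_id := Subcat.Hom.ext e.hom_inv_id
        inv_hom_id := Subcat.Hom.ext e.inv_hom_id })
    (fun _ => rfl)

/-! ## Frame homomorphisms between frames of open sets -/

lemma frameHom_sSup_iff {L : Type u} [Order.Frame L] (p : FrameHom L Prop) {S : Set L} :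
    p (sSup S) ↔ ∃ a ∈ S, p a := by
  rw [map_sSup, sSup_Prop_eq]
  constructor
  · rintro ⟨_, ⟨a, ha, rfl⟩, hpa⟩
    exact ⟨a, ha, hpa⟩
  · rintro ⟨a, ha, hpa⟩
    exact ⟨_, ⟨a, ha, rfl⟩, hpa⟩

/-- Each point of the frame of open sets of a Hausdorff space is given by a point of the space. -/
lemma exists_forall_mem_iff {X : Type u} [TopologicalSpace X] [T2Space X]
    (p : FrameHom (Opens X) Prop) : ∃ x : X, ∀ U : Opens X, x ∈ U ↔ p U := by
  -- `W` is the largest open set on which `p` fails; the point sought is any point outside it.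
  set W : Opens X := sSup {U | ¬ p U} with hW
  have hpW : ¬ p W := by
    rw [hW, frameHom_sSup_iff]
    rintro ⟨U, hU, hpU⟩
    exact hU hpU
  have hle : ∀ {U : Opens X}, ¬ p U → U ≤ W := fun hU => le_sSup hU
  have hne : ∃ x, x ∉ W := by
    by_contra! H
    refine hpW ?_
    rw [show W = ⊤ from top_le_iff.1 fun x _ => H x, map_top]
    trivial
  obtain ⟨x, hx⟩ := hne
  refine ⟨x, fun U => ⟨fun hxU => ?_, fun hpU => ?_⟩⟩
  · by_contra hpU
    exact hx (hle hpU hxU)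
  · by_contra hxU
    -- Separate each `z ∈ U` from `x` by disjoint `A`, `B`. As `B` contains `x ∉ W`, `p` holds at
    -- `B`, hence fails at `A`, so `z ∈ W`.
    refine hpW (OrderHomClass.mono p (fun z hzU => ?_ : U ≤ W) hpU)
    obtain ⟨A, B, hA, hB, hzA, hxB, hAB⟩ := t2_separation (fun e : z = x => hxU (e ▸ hzU))
    have hpAB : ¬ p (⟨A, hA⟩ ⊓ ⟨B, hB⟩) := by
      rw [show (⟨A, hA⟩ ⊓ ⟨B, hB⟩ : Opens X) = ⊥ from Opens.ext hAB.inter_eq, map_bot]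
      exact id
    have hpB : p ⟨B, hB⟩ := by
      by_contra h
      exact hx (hle h hxB)
    refine hle (U := ⟨A, hA⟩) (fun hpA => hpAB ?_) (hzA : z ∈ (⟨A, hA⟩ : Opens X))
    rw [map_inf]
    exact ⟨hpA, hpB⟩

/-- A frame homomorphism between the frames of open sets of two spaces, the first one Hausdorff,
is the inverse image map of a continuous map. -/
lemma exists_continuousMap_forall_eq_comap {X Y : Type u} [TopologicalSpace X]
    [TopologicalSpace Y] [T2Space Y] (h : FrameHom (Opens Y) (Opens X)) :
    ∃ f : C(X, Y), ∀ U : Opens Y, h U = Opens.comap f U := by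
  -- Composing `h` with the point of `Opens X` given by `x` yields a point of `Opens Y`, which names
  -- `f x`.
  choose f hf using fun x => exists_forall_mem_iff ((Locale.localePointOfSpacePoint X x).comp h)
  have hpre : ∀ U : Opens Y, f ⁻¹' U = h U := fun U => Set.ext fun x => hf x U
  exact ⟨⟨f, ⟨fun U hU => by rw [show U = (⟨U, hU⟩ : Opens Y) from rfl, hpre]; exact (h _).2⟩⟩,
    fun U => Opens.ext (hpre U).symm⟩

/-- Put `K` in the interior of a compact `L`. This interior is way below `⊤`, so its preimage lies
in a compact set, in which the closed preimage of `K` is compact. -/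
lemma isProperTop_of_wayBelow {X Y : TopCat.{u}} [LocallyCompactSpace X] [LocallyCompactSpace Y]
    [T2Space Y] (f : X ⟶ Y)
    (h : ∀ U V : Opens Y, WayBelow U V → WayBelow (Opens.comap f.hom U) (Opens.comap f.hom V)) :
    IsProperTop f := by
  intro K hK _
  obtain ⟨L, hL, hKL⟩ := exists_compact_superset hK
  obtain ⟨C, hC, hLC, -⟩ := wayBelow_opens_iff.1 (h ⟨interior L, isOpen_interior⟩ ⊤
    (wayBelow_opens_iff.2 ⟨L, hL, interior_subset, Set.subset_univ L⟩))
  exact hC.of_isClosed_subset (hK.isClosed.preimage f.hom.continuous)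
    ((Set.preimage_mono hKL).trans hLC)

/-! ## Points of a continuous regular frame -/

section Points

variable {L : Type u} [Order.Frame L]

lemma compl_sup_eq_top_finite_sSup {b : L} : ∀ {T : Set L}, T.Finite →
    (∀ a ∈ T, aᶜ ⊔ b = ⊤) → (sSup T)ᶜ ⊔ b = ⊤ := by
  intro T hT
  induction T, hT using Set.Finite.induction_on with
  | empty => simp
  | @insert c s _ _ ih =>
    intro h
    rw [sSup_insert, compl_sup, sup_inf_right, h c (Set.mem_insert c s),
      ih fun a ha => h a (Set.mem_insert_of_mem c ha), inf_top_eq]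

/-- In a regular frame, `a ≪ b` implies that `a` is well inside `b`. -/
lemma WayBelow.compl_sup_eq_top (hL : IsRegularFrame L) {a b : L} (h : WayBelow a b) :
    aᶜ ⊔ b = ⊤ := by
  obtain ⟨T, hT, hTf, haT⟩ := h _ (hL b).le
  exact top_le_iff.1 ((compl_sup_eq_top_finite_sSup hTf hT).ge.trans
    (sup_le_sup_right (compl_le_compl haT) b))

/-- If `c ≪ c' ≪ a`, then the complement of `cᶜ` is a compact sublocale. -/
lemma WayBelow.exists_finite_cover (hL : IsRegularFrame L) {c c' a : L} (h : WayBelow c c')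
    (h' : WayBelow c' a) {S : Set L} (hS : cᶜ ⊔ sSup S = ⊤) :
    ∃ T ⊆ S, T.Finite ∧ cᶜ ⊔ sSup T = ⊤ := by
  obtain ⟨T, hT, hTf, hcT⟩ := h' (insert cᶜ S) (by rw [sSup_insert, hS]; exact le_top)
  refine ⟨T \ {cᶜ}, fun t ht => (hT ht.1).resolve_left ht.2, hTf.subset Set.sdiff_subset, ?_⟩
  rw [← sSup_insert, Set.insert_sdiff_singleton, sSup_insert]
  -- `c` is well inside `c'`, so `cᶜ` together with any cover of `c'` gives the top.
  exact top_le_iff.1 ((h.compl_sup_eq_top hL).ge.trans (sup_le_sup_left hcT _))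

/-- A prime element of a frame gives a point. -/
def frameHomOfPrime (p : L) (hp : p ≠ ⊤) (hprime : ∀ a b, a ⊓ b ≤ p → a ≤ p ∨ b ≤ p) :
    FrameHom L Prop where
  toFun a := ¬ a ≤ p
  map_inf' a b := propext ⟨fun h => ⟨fun ha => h (inf_le_left.trans ha),
    fun hb => h (inf_le_right.trans hb)⟩, fun h hab => (hprime a b hab).elim h.1 h.2⟩
  map_top' := by simpa using hp
  map_sSup' S := by
    rw [sSup_Prop_eq, Set.exists_mem_image]
    simp

/-- A continuous regular frame has enough points. -/
lemma exists_point (hc : IsContinuousFrame L) (hr : IsRegularFrame L) {a b : L} (hab : ¬ a ≤ b) :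
    ∃ p : FrameHom L Prop, p a ∧ ¬ p b := by
  have step : ∀ {a : L}, ¬ a ≤ b → ∃ c, WayBelow c a ∧ ¬ c ≤ b := by
    intro a ha
    by_contra! H
    exact ha ((hc a).le.trans (sSup_le H))
  obtain ⟨c', hc'a, hc'b⟩ := step hab
  obtain ⟨c, hcc', hcb⟩ := step hc'b
  -- With `c ≪ c' ≪ a`, the condition `cᶜ ⊔ x ≠ ⊤` passes to joins of chains by
  -- `WayBelow.exists_finite_cover`, and it holds at `b` because `c ≰ b`. A maximal `p ≥ b` will be
  -- prime.
  obtain ⟨p, hbp, hp⟩ := zorn_le_nonempty₀ {x : L | cᶜ ⊔ x ≠ ⊤}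
    (fun C hC hchain y hy => by
      refine ⟨sSup C, fun hCtop => ?_, fun z hz => le_sSup hz⟩
      obtain ⟨T, hT, hTf, hTtop⟩ := hcc'.exists_finite_cover hr hc'a hCtop
      have key : ∃ x ∈ C, sSup T ≤ x := by
        clear hTtop
        induction T, hTf using Set.Finite.induction_on with
        | empty => exact ⟨y, hy, by simp⟩
        | @insert d s _ _ ih =>
          obtain ⟨x, hx, hsx⟩ := ih ((Set.subset_insert _ _).trans hT)
          have hd := hT (Set.mem_insert d s)
          rw [sSup_insert]
          rcases hchain.total hd hx with hdx | hxd
          · exact ⟨x, hx, sup_le hdx hsx⟩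
          · exact ⟨d, hd, sup_le le_rfl (hsx.trans hxd)⟩
      obtain ⟨x, hx, hTx⟩ := key
      exact hC hx (top_le_iff.1 (hTtop.ge.trans (sup_le_sup_left hTx _))))
    b (fun h => hcb (by
      calc c = c ⊓ (cᶜ ⊔ b) := by rw [h, inf_top_eq]
        _ = c ⊓ b := by rw [inf_sup_left, inf_compl_self, bot_sup_eq]
        _ ≤ b := inf_le_right))
  have hmax : ∀ x, ¬ x ≤ p → cᶜ ⊔ (p ⊔ x) = ⊤ := fun x hx => by
    by_contra h
    exact hx (le_sup_right.trans (hp.le_of_ge h le_sup_left))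
  refine ⟨frameHomOfPrime p (fun h => hp.prop (by rw [h, sup_top_eq])) fun x y hxy => ?_, ?_, ?_⟩
  · by_contra! H
    refine hp.prop ?_
    -- Distributivity gives `cᶜ ⊔ (p ⊔ x ⊓ y) = ⊤`, which is `cᶜ ⊔ p = ⊤` when `x ⊓ y ≤ p`.
    have h := congrArg₂ (· ⊓ ·) (hmax x H.1) (hmax y H.2)
    simp only [← sup_inf_left, inf_top_eq] at h
    rwa [sup_eq_left.2 hxy] at h
  · intro hap
    refine hp.prop (top_le_iff.1 ((hcc'.compl_sup_eq_top hr).ge.trans (sup_le_sup_left ?_ _)))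
    exact hc'a.le.trans hap
  · exact fun h => h hbp

/-- A continuous regular frame is isomorphic to the frame of open sets of its space of points. -/
noncomputable def opensPointsIso (hc : IsContinuousFrame L) (hr : IsRegularFrame L) :
    L ≃o Opens (Locale.PT L) :=
  RelIso.ofSurjective (OrderEmbedding.ofMapLEIff
    (fun a : L => (⟨{p | p a}, a, rfl⟩ : Opens (Locale.PT L))) (fun a b => by
      refine ⟨fun h => ?_, fun h p hp => OrderHomClass.mono p h hp⟩
      by_contra hab
      obtain ⟨p, hpa, hpb⟩ := exists_point hc hr hab
      exact hpb (@h p hpa)))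
    (fun U => by
      obtain ⟨a, ha⟩ := U.2
      exact ⟨a, Opens.ext ha⟩)

/-! ### Separation and local compactness of the space of points -/

lemma t2Space_points (hr : IsRegularFrame L) : T2Space (Locale.PT L) where
  t2 := by
    have key : ∀ {p q : Locale.PT L} {a : L}, p a → ¬ q a → ∃ U V : Set (Locale.PT L),
        IsOpen U ∧ IsOpen V ∧ p ∈ U ∧ q ∈ V ∧ Disjoint U V := by
      intro p q a hp hq
      -- Regularity gives `b` well inside `a` with `p b`; then `q` misses `a` and so satisfies `bᶜ`,
      -- and `b`, `bᶜ` define disjoint open sets.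
      rw [hr a, frameHom_sSup_iff] at hp
      obtain ⟨b, hb, hpb⟩ := hp
      have hq' : q (bᶜ ⊔ a) := by
        rw [hb, map_top]
        trivial
      rw [map_sup] at hq'
      refine ⟨{r | r b}, {r | r bᶜ}, ⟨b, rfl⟩, ⟨bᶜ, rfl⟩, hpb, hq'.resolve_right hq, ?_⟩
      rw [Set.disjoint_left]
      intro r hrb hrbc
      have : r (b ⊓ bᶜ) := by
        rw [map_inf]
        exact ⟨hrb, hrbc⟩
      rw [inf_compl_self, map_bot] at this
      exact this
    intro p q hpq
    obtain ⟨a, ha⟩ : ∃ a, ¬ (p a ↔ q a) := by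
      by_contra! H
      exact hpq (DFunLike.ext _ _ fun a => propext (H a))
    by_cases hp : p a
    · exact key hp fun hq => ha (iff_of_true hp hq)
    · obtain ⟨U, V, hU, hV, hqU, hpV, hUV⟩ := key (p := q) (q := p) (a := a) (by tauto) hp
      exact ⟨V, U, hV, hU, hpV, hqU, hUV.symm⟩

lemma exists_wayBelow_mem_point (hc : IsContinuousFrame L) {p : Locale.PT L} {a : L} (ha : p a) :
    ∃ b, WayBelow b a ∧ p b := by
  rwa [hc a, frameHom_sSup_iff] at ha

/-- For `c ≪ c' ≪ ⊤` with `p c`, the compact neighbourhood of `p` is the closed set of points that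
miss `cᶜ`. -/
lemma weaklyLocallyCompactSpace_points (hc : IsContinuousFrame L) (hr : IsRegularFrame L) :
    WeaklyLocallyCompactSpace (Locale.PT L) where
  exists_compact_mem_nhds p := by
    have hp : p ⊤ := by
      rw [map_top]
      trivial
    obtain ⟨c', hc', hpc'⟩ := exists_wayBelow_mem_point hc hp
    obtain ⟨c, hcc', hpc⟩ := exists_wayBelow_mem_point hc hpc'
    let e := opensPointsIso hc hr
    refine ⟨{q | ¬ q cᶜ}, ?_, mem_nhds_iff.2 ⟨{q | q c}, fun q hq hq' => ?_, ⟨c, rfl⟩, hpc⟩⟩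
    · refine isCompact_powerset_iff.1 fun (U : Set (Set _)) hU hcU => ?_
      -- Every point satisfies `cᶜ` or lies in the cover; since `L` has enough points, this becomes
      -- an identity in `L`.
      have hcov : cᶜ ⊔ sSup {a : L | {q : Locale.PT L | q a} ∈ U} = ⊤ := by
        refine top_le_iff.1 (e.le_iff_le.1 fun q _ => ?_)
        change q _
        rw [map_sup]
        by_cases hq : q cᶜ
        · exact Or.inl hq
        · obtain ⟨u, hu, hqu⟩ := Set.mem_sUnion.1 (hcU hq)
          obtain ⟨a, rfl⟩ := isOpen_powerset_iff.1 (hU u hu)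
          exact Or.inr ((frameHom_sSup_iff q).2 ⟨a, hu, hqu⟩)
      obtain ⟨T, hT, hTf, hTtop⟩ := hcc'.exists_finite_cover hr hc' hcov
      refine ⟨(fun a => {q : Locale.PT L | q a}) '' T, ?_, hTf.image _, fun q hq => ?_⟩
      · rintro _ ⟨a, ha, rfl⟩
        exact hT ha
      · have hq' : q (cᶜ ⊔ sSup T) := by
          rw [hTtop, map_top]
          trivial
        rw [map_sup] at hq'
        obtain ⟨a, ha, hqa⟩ := (frameHom_sSup_iff q).1 (hq'.resolve_left hq)
        exact Set.mem_sUnion.2 ⟨_, ⟨a, ha, rfl⟩, hqa⟩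
    · have : q (c ⊓ cᶜ) := by
        rw [map_inf]
        exact ⟨hq, hq'⟩
      rwa [inf_compl_self, map_bot] at this

end Points

/-! ## The equivalences -/

instance faithful_topCatOpToFrm : restrictsOfOp_topCatOpToFrm.{u}.functor.Faithful where
  map_injective {X Y} f g hfg := by
    have := X.unop.property.2
    refine Quiver.Hom.unop_inj (Subcat.Hom.ext (TopCat.hom_ext (ContinuousMap.ext fun y => ?_)))
    by_contra hne
    obtain ⟨U, V, hU, -, hfU, hgV, hUV⟩ := t2_separation hne
    have h : topCatOpToFrm.map f.unop.val.op = topCatOpToFrm.map g.unop.val.op :=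
      congrArg Subcat.Hom.val hfg
    have hgU : y ∈ Opens.comap g.unop.val.hom ⟨U, hU⟩ := by
      have : Opens.comap f.unop.val.hom ⟨U, hU⟩ = Opens.comap g.unop.val.hom ⟨U, hU⟩ :=
        congrArg (fun k => k.hom (⟨U, hU⟩ : Opens X.unop.val)) h
      rw [← this]
      exact hfU
    exact Set.disjoint_left.1 hUV hgU hgV

instance full_topCatOpToFrm : restrictsOfOp_topCatOpToFrm.{u}.functor.Full where
  map_surjective {X Y} h := by
    obtain ⟨_, _⟩ := X.unop.property
    obtain ⟨_, _⟩ := Y.unop.property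
    obtain ⟨f, hf⟩ := exists_continuousMap_forall_eq_comap (X := Y.unop.val) (Y := X.unop.val)
      h.val.hom
    have hfp : IsProperTop (TopCat.ofHom f) := isProperTop_of_wayBelow _ fun U V hUV => by
      have := h.property U V hUV
      rwa [show h.val U = Opens.comap f U from hf U, show h.val V = Opens.comap f V from hf V]
        at this
    exact ⟨Quiver.Hom.op ⟨TopCat.ofHom f, hfp⟩, Subcat.Hom.ext (Frm.ext fun U => (hf U).symm)⟩

instance essSurj_topCatOpToFrm : restrictsOfOp_topCatOpToFrm.{u}.functor.EssSurj where
  mem_essImage L := by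
    obtain ⟨hc, hr⟩ := L.property
    have h₁ := t2Space_points hr
    have := weaklyLocallyCompactSpace_points hc hr
    have h₂ : LocallyCompactSpace (Locale.PT L.val) := inferInstance
    let e := Frm.Iso.mk (α := Frm.of (Opens (Locale.PT L.val))) (β := L.val)
      (opensPointsIso hc hr).symm
    exact ⟨op ⟨TopCat.of (Locale.PT L.val), h₂, h₁⟩, ⟨{
      hom := ⟨e.hom, fun _ _ h => h.map_orderIso (opensPointsIso hc hr).symm⟩
      inv := ⟨e.inv, fun _ _ h => h.map_orderIso (opensPointsIso hc hr)⟩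
      hom_inv_id := Subcat.Hom.ext e.hom_inv_id
      inv_hom_id := Subcat.Hom.ext e.inv_hom_id }⟩⟩

instance isEquivalence_topCatOpToFrm :
    restrictsOfOp_topCatOpToFrm.{u}.functor.IsEquivalence where

lemma isEquivalence_powersetFunctor_comp_openFunctor :
    (restrictsOfOp_powersetFunctor.{u}.functor ⋙ restricts_openFunctor.functor).IsEquivalence :=
  Functor.isEquivalence_of_iso powersetOpenIso.symm

/-- Cancellation: `𝒫` and its composite with `𝒪` are equivalences. -/
lemma isEquivalence_openFunctor : restricts_openFunctor.{u}.functor.IsEquivalence :=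
  have := isEquivalence_powersetFunctor.{u}
  have := isEquivalence_powersetFunctor_comp_openFunctor.{u}
  Functor.isEquivalence_of_comp_left restrictsOfOp_powersetFunctor.functor _

theorem mainTheorem8 :
    -- locally compact Hausdorff MT-algebras are sober and spatial
    (∀ M : MTAlg.{u}, LCHMT.obj M → M.IsSober ∧ M.IsSpatial) ∧
    -- the functors involved restrict to the categories in question
    ∃ (hO : Subcat.Restricts MTAlg.openFunctor.{u} LCHMT CRegFrm)
      (hAt : Subcat.RestrictsToOp MTAlg.atFunctor.{u} LCHMT LCHaus)
      (hP : Subcat.RestrictsOfOp MTAlg.powersetFunctor.{u} LCHaus LCHMT)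
      (hΩ : Subcat.RestrictsOfOp topCatOpToFrm.{u} LCHaus CRegFrm),
      -- the restriction of `𝒪` is an equivalence
      hO.functor.IsEquivalence ∧
      -- the dual adjunction `(𝒫, at)` restricts to a dual equivalence
      Subcat.RestrictsToDualEquivalence MTAlg.dualAdjunction hAt hP ∧
      -- the two together give the duality between continuous regular frames and locally compact
      -- Hausdorff spaces, and this is the one given by the frames of open sets
      (hP.functor ⋙ hO.functor).IsEquivalence ∧
      Nonempty (hP.functor ⋙ hO.functor ≅ hΩ.functor) := by
  exact ⟨fun M hM => ⟨hM.2.isSober (isSpatial_of_LCHMT hM), isSpatial_of_LCHMT hM⟩,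
    restricts_openFunctor, restrictsToOp_atFunctor, restrictsOfOp_powersetFunctor,
    restrictsOfOp_topCatOpToFrm, isEquivalence_openFunctor, restrictsToDualEquivalence,
    isEquivalence_powersetFunctor_comp_openFunctor, ⟨powersetOpenIso⟩⟩
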